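/- Let $n\ge 0$. A \emph{subvariety} of $(\mathbb{C}^\times)^n$ is the set of common zeros of finitely many Laurent polynomials; $\dim$ denotes dimension as a complex variety (for a set that is not closed, the dimension of its Zariski closure). The \emph{amoeba} $\mathscr{A}(V)\subset\mathbb{R}^n$ of a subvariety $V\subset(\mathbb{C}^\times)^n$ is its image under the map $\mathrm{Log}(x_1,\dots,x_n)=(\log|x_1|,\dots,\log|x_n|)$, and $\dim_{\mathbb{R}}\mathscr{A}(V)$ is its dimension as a real analytic set, i.e. the largest $d$ such that $\mathscr{A}(V)$ contains the image of a nonempty open subset of $\mathbb{R}^d$ under a real analytic immersion. A \emph{subtorus} of $(\mathbb{C}^\times)^n$ is a subgroup generated by the images of the one-parameter subgroups $t\mapsto(t^{p_1},\dots,t^{p_n})$, $t\in\mathbb{C}^\times$, with $p=(p_1,\dots,p_n)$ ranging over a saturated subgroup of $\mathbb{Z}^n$. For an irreducible subvariety $V\subset(\mathbb{C}^\times)^n$ and a subtorus $\mathbb{T}\subset(\mathbb{C}^\times)^n$, let $W:=(\mathbb{T}\cdot V)/\mathbb{T}$ be the image of $V$ in the quotient torus $(\mathbb{C}^\times)^n/\mathbb{T}$.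 We say that $\mathbb{T}$ has a \emph{diminishing action} on $V$ if \[ \dim\mathbb{T} < 2(\dim V-\dim W)\quad\text{and}\quad 2\dim W < n-\dim\mathbb{T}. \] \textbf{Theorem.} Let $V\subset(\mathbb{C}^\times)^n$ be an irreducible subvariety. If some subtorus $\mathbb{T}$ of $(\mathbb{C}^\times)^n$ with $\{1\}\neq\mathbb{T}\neq(\mathbb{C}^\times)^n$ has a diminishing action on $V$, then \[ \dim_{\mathbb{R}}\mathscr{A}(V)<\min\{n,\,2\dim V\}. \] -/

import Mathlib

open scoped Pointwise

noncomputable section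

namespace TorusAmoeba

/-- The algebraic torus `(ℂ^×)^n`. -/
abbrev Torus (n : ℕ) : Type := Fin n → ℂˣ

/-- Pullback of complex-valued functions along a map `g`, as a homomorphism of algebras. -/
def pullback {X Y : Type} (g : X → Y) : (Y → ℂ) →ₐ[ℂ] (X → ℂ) where
  toFun f := f ∘ g
  map_one' := rfl
  map_mul' _ _ := rfl
  map_zero' := rfl
  map_add' _ _ := rfl
  commutes' _ := rfl

/-- The regular functions on `(ℂ^×)^n`: the Laurent polynomials, that is, the polynomial
expressions with complex coefficients in the coordinates and their inverses. -/
def regularFunctions (n : ℕ) : Subalgebra ℂ (Torus n → ℂ) :=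
  Algebra.adjoin ℂ
    (Set.range (fun (i : Fin n) (x : Torus n) => ((x i : ℂˣ) : ℂ)) ∪
      Set.range (fun (i : Fin n) (x : Torus n) => (((x i)⁻¹ : ℂˣ) : ℂ)))

/-- A subvariety of `(ℂ^×)^n`: the set of common zeros of finitely many Laurent polynomials. -/
def IsSubvariety {n : ℕ} (V : Set (Torus n)) : Prop :=
  ∃ F : Finset (Torus n → ℂ), (∀ f ∈ F, f ∈ regularFunctions n) ∧
    V = {x | ∀ f ∈ F, f x = 0}

/-- An irreducible subvariety of `(ℂ^×)^n`: a nonempty subvariety that is not contained in a union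
of two subvarieties unless it is contained in one of them. -/
def IsIrreducibleSubvariety {n : ℕ} (V : Set (Torus n)) : Prop :=
  IsSubvariety V ∧ V.Nonempty ∧
    ∀ Z₁ Z₂ : Set (Torus n), IsSubvariety Z₁ → IsSubvariety Z₂ → V ⊆ Z₁ ∪ Z₂ →
      V ⊆ Z₁ ∨ V ⊆ Z₂

/-- Let `A` be the algebra of regular functions of an affine variety with point set `X`. The
(complex) dimension of a subset `S` of `X`: the Krull dimension of the ring of restrictions to `S`
of the regular functions. That ring is the coordinate ring of the Zariski closure of `S`. -/
def algDim {X : Type} (A : Subalgebra ℂ (X → ℂ)) (S : Set X) : WithBot ℕ∞ :=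
  ringKrullDim (A.map (pullback (Subtype.val : S → X)))

/-- The dimension of a subset of `(ℂ^×)^n` as a complex variety. -/
def cdim {n : ℕ} (S : Set (Torus n)) : WithBot ℕ∞ :=
  algDim (regularFunctions n) S

/-- The cocharacter `t ↦ (t ^ p₁, …, t ^ pₙ)` of `(ℂ^×)^n` with exponent vector `p ∈ ℤ^n`. -/
def cochar {n : ℕ} (p : Fin n → ℤ) : ℂˣ →* Torus n where
  toFun t i := t ^ p i
  map_one' := by ext i; simp
  map_mul' s t := by ext i; simp [mul_zpow]

/-- A subtorus of `(ℂ^×)^n`: a subgroup generated by the images of the cocharacters with exponent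
vectors in some saturated subgroup `P` of `ℤ^n`. -/
def IsSubtorus {n : ℕ} (T : Subgroup (Torus n)) : Prop :=
  ∃ P : AddSubgroup (Fin n → ℤ),
    (∀ (k : ℤ) (p : Fin n → ℤ), k ≠ 0 → k • p ∈ P → p ∈ P) ∧
      T = ⨆ p ∈ P, (cochar p).range

/-- The regular functions on the quotient torus `(ℂ^×)^n / T`: the functions whose pullbacks to
`(ℂ^×)^n` are regular (these pullbacks are the `T`-invariant Laurent polynomials). -/
def quotientRegularFunctions {n : ℕ} (T : Subgroup (Torus n)) :
    Subalgebra ℂ (Torus n ⧸ T → ℂ) :=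
  (regularFunctions n).comap (pullback (QuotientGroup.mk : Torus n → Torus n ⧸ T))

/-- The image `W = (T · V) / T` of `V` in the quotient torus `(ℂ^×)^n / T`. -/
def quotientImage {n : ℕ} (T : Subgroup (Torus n)) (V : Set (Torus n)) : Set (Torus n ⧸ T) :=
  (QuotientGroup.mk : Torus n → Torus n ⧸ T) '' ((T : Set (Torus n)) * V)

/-- The dimension of a subset of the quotient torus `(ℂ^×)^n / T` as a complex variety. -/
def quotientDim {n : ℕ} (T : Subgroup (Torus n)) (S : Set (Torus n ⧸ T)) : WithBot ℕ∞ :=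
  algDim (quotientRegularFunctions T) S

/-- `T` has a diminishing action on `V`: with `W` the image of `V` in `(ℂ^×)^n / T`,
`dim T < 2 (dim V - dim W)` and `2 dim W < n - dim T`. The subtracted terms are written on the
other side, since the dimensions are elements of `WithBot ℕ∞`. -/
def HasDiminishingAction {n : ℕ} (T : Subgroup (Torus n)) (V : Set (Torus n)) : Prop :=
  cdim (T : Set (Torus n)) + 2 * quotientDim T (quotientImage T V) < 2 * cdim V ∧
    2 * quotientDim T (quotientImage T V) + cdim (T : Set (Torus n)) < (n : WithBot ℕ∞)

/-- The map `Log : (ℂ^×)^n → ℝ^n`, `x ↦ (log |x₁|, …, log |xₙ|)`. -/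
def Log {n : ℕ} (x : Torus n) : Fin n → ℝ := fun i => Real.log ‖(x i : ℂ)‖

/-- The amoeba of `V`: its image under `Log`. -/
def amoeba {n : ℕ} (V : Set (Torus n)) : Set (Fin n → ℝ) := Log '' V

/-- The real dimension of a (semi- or sub-)analytic subset `S` of `ℝ^n`: the largest `d` such that
`S` contains a nonempty `d`-dimensional real analytic submanifold piece, given by a real analytic
immersion of a nonempty open subset of `ℝ^d`. It is `⊥` for the empty set. -/
def realDim {n : ℕ} (S : Set (Fin n → ℝ)) : WithBot ℕ∞ :=
  sSup {e : WithBot ℕ∞ | ∃ d : ℕ, e = (d : WithBot ℕ∞) ∧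
    ∃ (U : Set (Fin d → ℝ)) (φ : (Fin d → ℝ) → (Fin n → ℝ)),
      IsOpen U ∧ U.Nonempty ∧ AnalyticOnNhd ℝ φ U ∧
        (∀ u ∈ U, Function.Injective (fderiv ℝ φ u)) ∧ φ '' U ⊆ S}

end TorusAmoeba

end

namespace TorusAmoeba

open MvPolynomial

/-! Every `d`-dimensional immersed piece of the amoeba satisfies `d ≤ dim T + 2 dim W`, and the
diminishing action says precisely that this bound is below both `n` and `2 dim V`.

Let `Λ` be the real span of the exponents of the characters trivial on `T`. Coordinates independent
modulo `Λ` are algebraically independent on `T`, so `n - dim Λ ≤ dim T` (`exists_le_cdim`). The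
functionals in `Λ` have rank at least `d + dim Λ - n` on a tangent space of the piece
(`exists_surjective_functionals`), so at least `d - dim T` invariant characters `χ` have values `log
|χ|` filling an open set. Their squares `|χ|²` are then algebraically independent functions on `W`.
By Noether normalization, `χ` and its conjugate are integral over polynomials in at most `dim W`
functions and their conjugates, so there are at most `2 dim W` such characters
(`card_le_two_mul_ringKrullDim`). -/

/-! ### Integrality, algebraic independence and Krull dimension -/

/-- The Krull dimension does not drop along an injective integral extension. -/
theorem ringKrullDim_le_of_isIntegral {R S : Type*} [CommRing R] [CommRing S] (f : R →+* S)
    (hf : Function.Injective f) (hint : f.IsIntegral) : ringKrullDim R ≤ ringKrullDim S := by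
  algebraize [f]
  have : FaithfulSMul R S := (faithfulSMul_iff_algebraMap_injective R S).2 hf
  refine iSup_le fun l => ?_
  obtain ⟨Q, -, hQ, hQl⟩ := Ideal.exists_ideal_over_prime_of_isIntegral
    (S := S) l.head.asIdeal ⊥ (by
      exact ((RingHom.injective_iff_ker_eq_bot _).1 hf).le.trans bot_le)
  have : Q.LiesOver l.head.asIdeal := ⟨hQl.symm⟩
  obtain ⟨L, hL, -⟩ := Ideal.exists_ltSeries_of_hasGoingUp l Q
  rw [← hL]
  exact Order.LTSeries.length_le_krullDim L

/-- Algebraically independent elements of a domain that are integral over a polynomial algebra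
are at most as many as the variables. -/
theorem card_le_of_isIntegralElem_of_isDomain {K S ι κ : Type} [Field K] [CommRing S] [IsDomain S]
    [Algebra K S] [Fintype ι] [Fintype κ] {z : κ → S} {g : ι → S} (hg : AlgebraicIndependent K g)
    (hint : ∀ i, (aeval z : MvPolynomial κ K →ₐ[K] S).toRingHom.IsIntegralElem (g i)) :
    Fintype.card ι ≤ Fintype.card κ := by
  -- In the matroid of algebraic independence, integral elements lie in the closure of `z`, whose
  -- rank is at most the number of variables.
  have hz : ∀ i, g i ∈ (AlgebraicIndependent.matroid K S).closure (Set.range z) := by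
    intro i
    rw [AlgebraicIndependent.matroid_closure_eq]
    change IsAlgebraic _ _
    apply IsIntegral.isAlgebraic
    obtain ⟨p, hp, hpg⟩ := hint i
    have hmem : ∀ q : MvPolynomial κ K, aeval z q ∈ Algebra.adjoin K (Set.range z) := fun q => by
      rw [Algebra.adjoin_range_eq_range_aeval]; exact ⟨q, rfl⟩
    let ψ : MvPolynomial κ K →+* Algebra.adjoin K (Set.range z) :=
      (aeval z : MvPolynomial κ K →ₐ[K] S).toRingHom.codRestrict _ hmem
    refine ⟨p.map ψ, hp.map _, ?_⟩
    rw [Polynomial.eval₂_map]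
    exact hpg
  have hind : (AlgebraicIndependent.matroid K S).Indep (Set.range g) :=
    AlgebraicIndependent.matroid_indep_iff.2 hg.coe_range
  have h := hind.eRk_eq_encard.symm.le.trans
    (((AlgebraicIndependent.matroid K S).eRk_mono (Set.range_subset_iff.2 hz)).trans
      (((AlgebraicIndependent.matroid K S).eRk_closure_eq _).le.trans
        ((AlgebraicIndependent.matroid K S).eRk_le_encard _)))
  rw [← Set.image_univ, hg.injective.encard_image, Set.encard_univ, ENat.card_eq_coe_fintype_card]
    at h
  have h2 : (Set.range z).encard ≤ (Fintype.card κ : ℕ∞) := by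
    rw [← Set.image_univ, ← ENat.card_eq_coe_fintype_card, ← Set.encard_univ]
    exact Set.encard_image_le _ _
  exact_mod_cast h.trans h2

/-- Needed because a ring of functions `X → ℂ` has zero divisors. The zero ideal of the polynomial
ring on `ι` is a minimal prime, hence the contraction of a prime `q` of `S`; modulo `q` the family
`g` stays independent. -/
theorem card_le_of_isIntegralElem {K S ι κ : Type} [Field K] [CommRing S]
    [Algebra K S] [Fintype ι] [Fintype κ] {z : κ → S} {g : ι → S} (hg : AlgebraicIndependent K g)
    (hint : ∀ i, (aeval z : MvPolynomial κ K →ₐ[K] S).toRingHom.IsIntegralElem (g i)) :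
    Fintype.card ι ≤ Fintype.card κ := by
  obtain ⟨q, hq, hq0⟩ := Ideal.exists_comap_eq_of_mem_minimalPrimes_of_injective
    (f := (aeval g : MvPolynomial ι K →ₐ[K] S).toRingHom) hg ⊥ (by
      simp [IsDomain.minimalPrimes_eq_singleton_bot])
  let π : S →ₐ[K] S ⧸ q := Ideal.Quotient.mkₐ K q
  have hcomp : ∀ {σ : Type} (y : σ → S),
      (aeval (fun i => π (y i)) : MvPolynomial σ K →ₐ[K] S ⧸ q) = π.comp (aeval y) := fun y =>
    MvPolynomial.algHom_ext fun i => by simp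
  refine card_le_of_isIntegralElem_of_isDomain (K := K) (S := S ⧸ q)
    (z := fun i => π (z i)) (g := fun i => π (g i)) ?_ ?_
  · rw [AlgebraicIndependent, hcomp, injective_iff_map_eq_zero]
    intro a ha
    have : a ∈ q.comap (aeval g : MvPolynomial ι K →ₐ[K] S).toRingHom :=
      (Ideal.Quotient.eq_zero_iff_mem (I := q)).1 ha
    rwa [hq0] at this
  · intro i
    rw [hcomp]
    exact (hint i).map π.toRingHom

theorem isIntegralElem_of_comp {R S T : Type*} [CommRing R] [CommRing S] [CommRing T]
    {f : R →+* S} {g : S →+* T} {x : T} (h : (g.comp f).IsIntegralElem x) :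
    g.IsIntegralElem x := by
  obtain ⟨p, hp, hx⟩ := h
  exact ⟨p.map f, hp.map f, by rwa [Polynomial.eval₂_map]⟩

/-- Noether normalization of a finitely generated algebra of complex functions. -/
theorem exists_noether_normalization {X : Type} [Nonempty X] {A : Subalgebra ℂ (X → ℂ)}
    (hA : A.FG) : ∃ (s : ℕ) (z : Fin s → X → ℂ), (s : WithBot ℕ∞) ≤ ringKrullDim A ∧
      ∀ f ∈ A, (aeval z : MvPolynomial (Fin s) ℂ →ₐ[ℂ] X → ℂ).toRingHom.IsIntegralElem f := by
  have : Algebra.FiniteType ℂ A := A.fg_iff_finiteType.1 hA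
  obtain ⟨s, g, hg, hint⟩ := exists_integral_inj_algHom_of_fg ℂ A
  refine ⟨s, fun i => (g (MvPolynomial.X i) : X → ℂ), ?_, fun f hf => ?_⟩
  · refine le_trans ?_ (ringKrullDim_le_of_isIntegral g.toRingHom hg hint)
    rw [MvPolynomial.ringKrullDim_of_isNoetherianRing]
    simp
  · have h := (hint ⟨f, hf⟩).map A.val.toRingHom
    have e : (aeval fun i => (g (MvPolynomial.X i) : X → ℂ) : MvPolynomial (Fin s) ℂ →ₐ[ℂ] X → ℂ) =
        A.val.comp g := by
      ext; simp
    rw [e]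
    exact h

/-- Algebraically independent elements of a finitely generated algebra are at most as many as its
Krull dimension. -/
theorem card_le_ringKrullDim {X ι : Type} [Nonempty X] [Fintype ι] {A : Subalgebra ℂ (X → ℂ)}
    (hA : A.FG) {f : ι → X → ℂ} (hf : ∀ i, f i ∈ A) (hind : AlgebraicIndependent ℂ f) :
    (Fintype.card ι : WithBot ℕ∞) ≤ ringKrullDim A := by
  obtain ⟨s, z, hs, hint⟩ := exists_noether_normalization hA
  have := card_le_of_isIntegralElem hind fun i => hint _ (hf i)
  rw [Fintype.card_fin] at this
  exact le_trans (by exact_mod_cast this) hs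

/-- If the squared absolute values of elements of a finitely generated algebra of complex functions
are algebraically independent, they are at most twice as many as the Krull dimension. -/
theorem card_le_two_mul_ringKrullDim {X ι : Type} [Nonempty X] [Fintype ι]
    {A : Subalgebra ℂ (X → ℂ)} (hA : A.FG) {f : ι → X → ℂ} (hf : ∀ i, f i ∈ A)
    (hind : AlgebraicIndependent ℂ fun i => f i * star (f i)) :
    (Fintype.card ι : WithBot ℕ∞) ≤ 2 * ringKrullDim A := by
  obtain ⟨s, z, hs, hint⟩ := exists_noether_normalization hA
  have key := card_le_of_isIntegralElem (z := Sum.elim z (star z)) hind fun i => ?_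
  · rw [Fintype.card_sum, Fintype.card_fin, ← two_mul] at key
    have h2 : (Fintype.card ι : WithBot ℕ∞) ≤ 2 * (s : WithBot ℕ∞) := by exact_mod_cast key
    refine h2.trans ?_
    gcongr
  -- `f i` is integral over the `z`-variables and its conjugate over the `star z`-variables.
  -- Conjugation is only semilinear, so the second inclusion also conjugates coefficients.
  · refine RingHom.IsIntegralElem.mul _ (isIntegralElem_of_comp
      (f := (rename Sum.inl : MvPolynomial (Fin s) ℂ →ₐ[ℂ] _).toRingHom) ?_)
      (isIntegralElem_of_comp
      (f := (rename Sum.inr : MvPolynomial (Fin s) ℂ →ₐ[ℂ] _).toRingHom.comp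
        (MvPolynomial.map (starRingEnd ℂ))) ?_)
    · have e : (aeval (Sum.elim z (star z)) : MvPolynomial _ ℂ →ₐ[ℂ] X → ℂ).toRingHom.comp
          (rename Sum.inl : MvPolynomial (Fin s) ℂ →ₐ[ℂ] _).toRingHom = (aeval z).toRingHom :=
        MvPolynomial.ringHom_ext (fun c => by simp) fun j => by simp
      rw [e]
      exact hint _ (hf i)
    · have e : (aeval (Sum.elim z (star z)) : MvPolynomial _ ℂ →ₐ[ℂ] X → ℂ).toRingHom.comp
          ((rename Sum.inr : MvPolynomial (Fin s) ℂ →ₐ[ℂ] _).toRingHom.comp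
            (MvPolynomial.map (starRingEnd ℂ))) =
          (starRingEnd (X → ℂ)).comp (aeval z).toRingHom :=
        MvPolynomial.ringHom_ext (fun c => by ext x; simp) fun j => by ext x; simp
      rw [e]
      exact (hint _ (hf i)).map (starRingEnd (X → ℂ))

/-! ### Characters and Laurent polynomials -/

/-- The character `x ↦ x₁ ^ m₁ ⋯ xₙ ^ mₙ` of the torus. -/
def character {n : ℕ} (m : Fin n → ℤ) : Torus n →* ℂˣ where
  toFun x := ∏ i, x i ^ m i
  map_one' := by simp
  map_mul' x y := by simp [mul_zpow, Finset.prod_mul_distrib]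

theorem character_apply {n : ℕ} (m : Fin n → ℤ) (x : Torus n) :
    character m x = ∏ i, x i ^ m i := rfl

theorem character_add {n : ℕ} (m m' : Fin n → ℤ) :
    character (m + m') = character m * character m' := by
  ext x
  simp [character_apply, zpow_add, Finset.prod_mul_distrib]

theorem character_zero {n : ℕ} : character (0 : Fin n → ℤ) = 1 := by
  ext x
  simp [character_apply]

/-- A character as a regular function. -/
def characterFun {n : ℕ} (m : Fin n → ℤ) (x : Torus n) : ℂ := character m x

theorem characterFun_add {n : ℕ} (m m' : Fin n → ℤ) :
    characterFun (m + m') = characterFun m * characterFun m' := by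
  ext x
  simp [characterFun, character_add]

theorem characterFun_zero {n : ℕ} : characterFun (0 : Fin n → ℤ) = 1 := by
  ext x
  simp [characterFun, character_zero]

theorem character_single {n : ℕ} (i : Fin n) (k : ℤ) (x : Torus n) :
    character (Pi.single i k) x = x i ^ k := by
  rw [character_apply, Finset.prod_eq_single i]
  · simp
  · intro j _ hj
    simp [hj]
  · simp

theorem character_injective {n : ℕ} : Function.Injective (character (n := n)) := by
  intro m m' h
  ext i
  have h1 := congrArg (fun u : ℂˣ => ‖(u : ℂ)‖)
    (DFunLike.congr_fun h (Pi.mulSingle i (Units.mk0 (2 : ℂ) two_ne_zero)))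
  have h2 : ∀ k : Fin n → ℤ, ‖((character k
      (Pi.mulSingle i (Units.mk0 (2 : ℂ) two_ne_zero)) : ℂˣ) : ℂ)‖ = (2 : ℝ) ^ k i := by
    intro k
    rw [character_apply, Finset.prod_eq_single i]
    · simp
    · intro j _ hj
      simp [hj]
    · simp
  simp only [h2] at h1
  exact zpow_right_injective₀ (by norm_num) (by norm_num) h1

theorem characterFun_mem {n : ℕ} (m : Fin n → ℤ) : characterFun m ∈ regularFunctions n := by
  have h : characterFun m = ∏ i, (fun x : Torus n => ((x i ^ m i : ℂˣ) : ℂ)) := by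
    ext x
    simp [characterFun, character_apply]
  rw [h]
  refine Subalgebra.prod_mem _ fun i _ => ?_
  obtain ⟨k, hk | hk⟩ := (m i).eq_nat_or_neg
  · have : (fun x : Torus n => ((x i ^ m i : ℂˣ) : ℂ)) = (fun x => ((x i : ℂˣ) : ℂ)) ^ k := by
      ext x
      simp [hk]
    rw [this]
    refine pow_mem (Algebra.subset_adjoin ?_) k
    exact Set.mem_union_left _ ⟨i, rfl⟩
  · have : (fun x : Torus n => ((x i ^ m i : ℂˣ) : ℂ)) = (fun x => (((x i)⁻¹ : ℂˣ) : ℂ)) ^ k := by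
      ext x
      simp [hk]
    rw [this]
    refine pow_mem (Algebra.subset_adjoin ?_) k
    exact Set.mem_union_right _ ⟨i, rfl⟩

/-- Regular functions on the torus are linear combinations of characters. -/
theorem mem_span_characterFun {n : ℕ} {f : Torus n → ℂ} (hf : f ∈ regularFunctions n) :
    f ∈ Submodule.span ℂ (Set.range (characterFun (n := n))) := by
  rw [regularFunctions, ← Subalgebra.mem_toSubmodule, Algebra.adjoin_eq_span] at hf
  refine Submodule.span_mono ?_ hf
  intro g hg
  induction hg using Submonoid.closure_induction with
  | mem g hg =>
    rcases hg with ⟨i, rfl⟩ | ⟨i, rfl⟩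
    · refine ⟨Pi.single i 1, ?_⟩
      ext x
      simp [characterFun, character_single]
    · refine ⟨Pi.single i (-1), ?_⟩
      ext x
      simp [characterFun, character_single]
  | one => exact ⟨0, characterFun_zero⟩
  | mul a b _ _ ha hb =>
    obtain ⟨m, rfl⟩ := ha
    obtain ⟨m', rfl⟩ := hb
    exact ⟨m + m', characterFun_add m m'⟩

/-- Distinct characters of a monoid with values in `ℂˣ` are linearly independent. -/
theorem linearIndependent_characters {G ι : Type} [Monoid G] {c : ι → G →* ℂˣ}
    (hc : Function.Injective c) :
    LinearIndependent ℂ fun i (x : G) => ((c i x : ℂˣ) : ℂ) := by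
  have h := (linearIndependent_monoidHom G ℂ).comp (fun i => (Units.coeHom ℂ).comp (c i)) ?_
  · exact h
  · intro i j hij
    apply hc
    ext x
    exact DFunLike.congr_fun hij x

/-! ### Invariant characters and the quotient torus -/

/-- The exponents of the characters that are trivial on `T`. -/
def annihilator {n : ℕ} (T : Subgroup (Torus n)) : AddSubgroup (Fin n → ℤ) where
  carrier := {m | ∀ t ∈ T, character m t = 1}
  zero_mem' t _ := by simp [character_zero]
  add_mem' {a b} ha hb t ht := by
    simp only [Set.mem_ofPred_eq] at ha hb
    simp [character_add, ha t ht, hb t ht]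
  neg_mem' {a} ha t ht := by
    have h : character (-a) t * character a t = 1 := by
      rw [← MonoidHom.mul_apply, ← character_add, neg_add_cancel, character_zero]
      rfl
    rwa [ha t ht, mul_one] at h

/-- Regular functions that are invariant under `T` are combinations of invariant characters. -/
theorem mem_span_of_invariant {n : ℕ} {T : Subgroup (Torus n)} {f : Torus n → ℂ}
    (hf : f ∈ regularFunctions n) (hinv : ∀ t ∈ T, ∀ x, f (t * x) = f x) :
    f ∈ Submodule.span ℂ (characterFun '' (annihilator T : Set (Fin n → ℤ))) := by
  obtain ⟨c, rfl⟩ := (Finsupp.mem_span_range_iff_exists_finsupp).1 (mem_span_characterFun hf)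
  have hli := linearIndependent_characters (character_injective (n := n))
  rw [linearIndependent_iff'] at hli
  refine Submodule.sum_mem _ fun m hm => Submodule.smul_mem _ _
    (Submodule.subset_span ⟨m, fun t ht => ?_, rfl⟩)
  -- Invariance under `t` is a linear relation between distinct characters, so each coefficient `c k
  -- * (character k t - 1)` vanishes.
  have h := hli c.support (fun k => c k * (character k t - 1)) (by
    ext x
    have h1 := hinv t ht x
    simp only [Finsupp.sum, Finset.sum_apply, Pi.smul_apply, smul_eq_mul, characterFun, map_mul,
      Units.val_mul] at h1
    simp only [Finset.sum_apply, Pi.smul_apply, smul_eq_mul, Pi.zero_apply]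
    rw [← sub_eq_zero, ← Finset.sum_sub_distrib] at h1
    rw [← h1]
    exact Finset.sum_congr rfl fun k _ => by ring) m hm
  have h2 := (mul_eq_zero.1 h).resolve_left (Finsupp.mem_support_iff.1 hm)
  exact Units.ext (sub_eq_zero.1 h2)

/-- The function on the quotient torus induced by an invariant character. -/
def quotientCharacter {n : ℕ} (T : Subgroup (Torus n)) (m : annihilator T) (y : Torus n ⧸ T) : ℂ :=
  (QuotientGroup.lift T (character m.1) (fun t ht => m.2 t ht) y : ℂˣ)

theorem pullback_quotientCharacter {n : ℕ} (T : Subgroup (Torus n)) (m : annihilator T) :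
    pullback (QuotientGroup.mk : Torus n → Torus n ⧸ T) (quotientCharacter T m) =
      characterFun m.1 := rfl

theorem quotientCharacter_mem {n : ℕ} (T : Subgroup (Torus n)) (m : annihilator T) :
    quotientCharacter T m ∈ quotientRegularFunctions T := by
  change pullback _ _ ∈ regularFunctions n
  rw [pullback_quotientCharacter]
  exact characterFun_mem _

theorem fg_adjoin_characterFun {n : ℕ} (L : AddSubgroup (Fin n → ℤ)) :
    (Algebra.adjoin ℂ (characterFun '' (L : Set (Fin n → ℤ)))).FG := by
  -- Monoid generators are needed: products in the algebra give no inverses.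
  obtain ⟨S, hS⟩ : L.toAddSubmonoid.FG := by
    rw [← AddSubgroup.fg_iff_addSubmonoid_fg, ← AddSubgroup.toIntSubmodule_toAddSubgroup L,
      ← Submodule.fg_iff_addSubgroup_fg]
    exact IsNoetherian.noetherian _
  have : Algebra.adjoin ℂ (characterFun '' (L : Set (Fin n → ℤ))) =
      Algebra.adjoin ℂ (characterFun '' (S : Set (Fin n → ℤ))) := by
    apply le_antisymm
    · refine Algebra.adjoin_le ?_
      rintro _ ⟨m, hm, rfl⟩
      have hm' : m ∈ AddSubmonoid.closure (S : Set (Fin n → ℤ)) := by rw [hS]; exact hm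
      induction hm' using AddSubmonoid.closure_induction with
      | mem m h => exact Algebra.subset_adjoin ⟨m, h, rfl⟩
      | zero => rw [characterFun_zero]; exact one_mem _
      | add a b ha hb iha ihb =>
        rw [hS] at ha hb
        rw [characterFun_add]
        exact mul_mem (iha ha) (ihb hb)
    · refine Algebra.adjoin_mono (Set.image_mono ?_)
      intro m hm
      have := AddSubmonoid.subset_closure hm
      rw [hS] at this
      exact this
  rw [this]
  exact Subalgebra.fg_def.2 ⟨_, S.finite_toSet.image _, rfl⟩

theorem fg_regularFunctions (n : ℕ) : (regularFunctions n).FG :=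
  Subalgebra.fg_def.2 ⟨_, (Set.finite_range _).union (Set.finite_range _), rfl⟩

theorem fg_quotientRegularFunctions {n : ℕ} (T : Subgroup (Torus n)) :
    (quotientRegularFunctions T).FG := by
  refine Subalgebra.fg_of_fg_map _ (pullback (QuotientGroup.mk : Torus n → Torus n ⧸ T)) ?_ ?_
  · intro f g h
    ext y
    obtain ⟨x, rfl⟩ := QuotientGroup.mk_surjective y
    exact congrFun h x
  convert fg_adjoin_characterFun (annihilator T) using 1
  apply le_antisymm
  · rintro _ ⟨f, hf, rfl⟩
    refine Algebra.span_le_adjoin _ _ (mem_span_of_invariant hf fun t ht x => ?_)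
    change f (QuotientGroup.mk (t * x)) = f (QuotientGroup.mk x)
    congr 1
    rw [QuotientGroup.eq]
    simpa using inv_mem ht
  · refine Algebra.adjoin_le ?_
    rintro _ ⟨m, hm, rfl⟩
    exact ⟨_, quotientCharacter_mem T ⟨m, hm⟩, rfl⟩

/-! ### Independent characters on `T` -/

/-- Characters with exponents that are independent modulo the annihilator of `T` restrict to
algebraically independent functions on `T`. -/
theorem algebraicIndependent_restrict {n : ℕ} (T : Subgroup (Torus n)) {ι : Type} [Fintype ι]
    (e : ι → Fin n → ℤ) (he : ∀ a : ι → ℤ, ∑ j, a j • e j ∈ annihilator T → a = 0) :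
    AlgebraicIndependent ℂ fun j =>
      pullback (Subtype.val : ↥(T : Set (Torus n)) → Torus n) (characterFun (e j)) := by
  -- Monomials in the chosen characters are again characters of `T`, pairwise distinct by `he`,
  -- hence linearly independent.
  have hli := linearIndependent_characters (G := T) (ι := ι →₀ ℕ)
    (c := fun s => (character (∑ j, (s j : ℤ) • e j)).comp T.subtype) (by
      intro s s' h
      have h0 := he (fun j => (s j : ℤ) - s' j) (fun t ht => by
        have h1 : character (∑ j, (s j : ℤ) • e j) t = character (∑ j, (s' j : ℤ) • e j) t :=
          DFunLike.congr_fun h ⟨t, ht⟩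
        have h2 : ∑ j, (s j : ℤ) • e j =
            ∑ j, ((s j : ℤ) - s' j) • e j + ∑ j, (s' j : ℤ) • e j := by
          rw [← Finset.sum_add_distrib]
          exact Finset.sum_congr rfl fun j _ => by rw [← add_smul, sub_add_cancel]
        rw [h2, character_add, MonoidHom.mul_apply] at h1
        exact mul_eq_right.1 h1)
      ext j
      have := congrFun h0 j
      simp only [Pi.zero_apply] at this
      omega)
  rw [linearIndependent_iff'] at hli
  rw [AlgebraicIndependent, injective_iff_map_eq_zero]
  intro p hp
  rw [aeval_def, eval₂_eq'] at hp
  have h := hli p.support (fun s => coeff s p) (by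
    rw [← hp]
    refine Finset.sum_congr rfl fun s _ => ?_
    rw [Algebra.smul_def]
    congr 1
    ext x
    have : ∀ u : Finset ι, characterFun (∑ j ∈ u, (s j : ℤ) • e j) =
        ∏ j ∈ u, characterFun (e j) ^ s j := by
      classical
      intro u
      induction u using Finset.induction_on with
      | empty => exact characterFun_zero
      | insert i u hi ih =>
        rw [Finset.sum_insert hi, Finset.prod_insert hi, characterFun_add, ih]
        congr 1
        generalize s i = k
        induction k with
        | zero => simp [characterFun_zero]
        | succ k ihk =>
          rw [Nat.cast_succ, add_smul, one_smul, characterFun_add, ihk, pow_succ]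
    have := congrFun (this Finset.univ) x.1
    simp only [Finset.prod_apply, Pi.pow_apply] at this ⊢
    exact this)
  ext s
  by_cases hs : s ∈ p.support
  · simpa using h s hs
  · simpa using hs

/-- The real subspace spanned by the exponents of the characters that are trivial on `T`. -/
def annihilatorSpan {n : ℕ} (T : Subgroup (Torus n)) : Submodule ℝ (Fin n → ℝ) :=
  Submodule.span ℝ (Set.range fun (m : annihilator T) (i : Fin n) => (m.1 i : ℝ))

/-- Some coordinates restrict to a basis of a complement of a given subspace. -/
theorem exists_linearIndependent_mkQ_single {n : ℕ} (Λ : Submodule ℝ (Fin n → ℝ)) :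
    ∃ (κ : Type) (_ : Fintype κ) (a : κ → Fin n), Fintype.card κ + Module.finrank ℝ Λ = n ∧
      LinearIndependent ℝ fun k => Λ.mkQ (Pi.single (a k) 1) := by
  obtain ⟨κ, a, ha, hspan, hli⟩ := exists_linearIndependent' ℝ
    (fun i : Fin n => Λ.mkQ (Pi.single i (1 : ℝ)))
  have : Fintype κ := Fintype.ofInjective a ha
  refine ⟨κ, this, a, ?_, hli⟩
  have htop : Submodule.span ℝ (Set.range fun i : Fin n => Λ.mkQ (Pi.single i (1 : ℝ))) = ⊤ := by
    have h : (fun i : Fin n => Λ.mkQ (Pi.single i (1 : ℝ))) = Λ.mkQ ∘ Pi.basisFun ℝ (Fin n) := by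
      ext i; simp
    rw [h, Set.range_comp, ← Submodule.map_span, (Pi.basisFun ℝ (Fin n)).span_eq,
      Submodule.map_top, Submodule.range_mkQ]
  have h1 := finrank_span_eq_card hli
  change Module.finrank ℝ (Submodule.span ℝ (Set.range ((fun i : Fin n =>
    Λ.mkQ (Pi.single i (1 : ℝ))) ∘ a))) = _ at h1
  rw [hspan, htop, finrank_top] at h1
  rw [← h1, Submodule.finrank_quotient_add_finrank, Module.finrank_fin_fun]

theorem exists_le_cdim {n : ℕ} (T : Subgroup (Torus n)) :
    ∃ r : ℕ, r + Module.finrank ℝ (annihilatorSpan T) = n ∧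
      (r : WithBot ℕ∞) ≤ cdim (T : Set (Torus n)) := by
  obtain ⟨κ, _, a, hcard, hli⟩ := exists_linearIndependent_mkQ_single (annihilatorSpan T)
  refine ⟨Fintype.card κ, hcard, ?_⟩
  have : Nonempty ↥(T : Set (Torus n)) := ⟨⟨1, T.one_mem⟩⟩
  refine card_le_ringKrullDim ((fg_regularFunctions n).map _) (fun j => ⟨_, characterFun_mem _, rfl⟩)
    (algebraicIndependent_restrict T (fun k => Pi.single (a k) 1) fun c hc => ?_)
  rw [Fintype.linearIndependent_iff] at hli
  have h := hli (fun k => (c k : ℝ)) (by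
    simp only [← map_smul]
    rw [← map_sum, ← LinearMap.mem_ker, Submodule.ker_mkQ]
    have hmem : (fun i => ((∑ j, c j • (Pi.single (a j) 1 : Fin n → ℤ)) i : ℝ)) ∈
        annihilatorSpan T :=
      Submodule.subset_span (Set.mem_range_self (⟨_, hc⟩ : annihilator T))
    convert hmem using 1
    ext i
    simp [Pi.single_apply, Finset.sum_apply])
  ext k
  exact_mod_cast h k

/-! ### Linear functionals on a tangent space -/

/-- A linearly independent finite family of functionals is jointly surjective. -/
theorem surjective_of_linearIndependent_dual {E κ : Type} [AddCommGroup E] [Module ℝ E] [Fintype κ]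
    {f : κ → Module.Dual ℝ E} (hf : LinearIndependent ℝ f) :
    Function.Surjective (LinearMap.pi f : E →ₗ[ℝ] κ → ℝ) := by
  classical
  rw [← LinearMap.range_eq_top]
  by_contra h
  obtain ⟨g, hg, hker⟩ := Submodule.exists_le_ker_of_lt_top _ (lt_top_iff_ne_top.2 h)
  apply hg
  have h0 := Fintype.linearIndependent_iff.1 hf (fun k => g (Pi.single k 1)) (by
    ext v
    have hv : g (LinearMap.pi f v) = 0 := hker ⟨v, rfl⟩
    rw [← Finset.univ_sum_single (LinearMap.pi f v), map_sum] at hv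
    rw [LinearMap.zero_apply, ← hv, LinearMap.sum_apply]
    refine Finset.sum_congr rfl fun k _ => ?_
    have hk : (Pi.single k (LinearMap.pi f v k) : κ → ℝ) =
        LinearMap.pi f v k • Pi.single k (1 : ℝ) := by
      rw [← Pi.single_smul', smul_eq_mul, mul_one]
    rw [hk, map_smul, LinearMap.smul_apply, smul_eq_mul, smul_eq_mul, mul_comm]
    rfl)
  ext k
  simpa using h0 k

/-- For an injective linear map `D` into `ℝⁿ` and a subspace spanned by functionals `q`, there are
at least `dim E + dim (span q) - n` of them that are jointly surjective on the range of `D`. -/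
theorem exists_surjective_functionals {n : ℕ} {E ι : Type} [AddCommGroup E] [Module ℝ E]
    [FiniteDimensional ℝ E] (D : E →ₗ[ℝ] Fin n → ℝ) (hD : Function.Injective D)
    (q : ι → Fin n → ℝ) :
    ∃ (κ : Type) (_ : Fintype κ) (a : κ → ι),
      Module.finrank ℝ E + Module.finrank ℝ (Submodule.span ℝ (Set.range q)) ≤
        Fintype.card κ + n ∧
      Function.Surjective (LinearMap.pi fun k => dotProductEquiv ℝ (Fin n) (q (a k)) ∘ₗ D :
        E →ₗ[ℝ] κ → ℝ) := by
  -- `Φ` restricts functionals to `E`. It is onto because `D` is injective, so its kernel has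
  -- dimension `n - dim E`, and the span of `q` loses at most that much.
  let Φ : (Fin n → ℝ) →ₗ[ℝ] Module.Dual ℝ E :=
    D.dualMap ∘ₗ (dotProductEquiv ℝ (Fin n)).toLinearMap
  have hΦ : Function.Surjective Φ :=
    (LinearMap.dualMap_surjective_of_injective hD).comp (dotProductEquiv ℝ (Fin n)).surjective
  obtain ⟨κ, a, ha, hspan, hli⟩ := exists_linearIndependent' ℝ (fun i => Φ (q i))
  have : Finite κ := LinearIndependent.finite hli
  have : Fintype κ := Fintype.ofFinite κ
  refine ⟨κ, this, a, ?_, surjective_of_linearIndependent_dual hli⟩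
  set Λ := Submodule.span ℝ (Set.range q)
  have h1 := finrank_span_eq_card hli
  have h2 := (Φ ∘ₗ Λ.subtype).finrank_range_add_finrank_ker
  have h3 := Φ.finrank_range_add_finrank_ker
  have h4 : Module.finrank ℝ (LinearMap.ker (Φ ∘ₗ Λ.subtype)) ≤
      Module.finrank ℝ (LinearMap.ker Φ) := by
    rw [LinearMap.ker_comp]
    refine LinearMap.finrank_le_finrank_of_injective
      (f := (Λ.subtype.restrict (p := (LinearMap.ker Φ).comap Λ.subtype) (q := LinearMap.ker Φ)
        fun x hx => hx)) fun x y hxy => ?_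
    exact Subtype.ext (Subtype.ext (congrArg (Subtype.val : LinearMap.ker Φ → _) hxy))
  rw [LinearMap.range_eq_top.2 hΦ, finrank_top, Subspace.dual_finrank_eq, Module.finrank_fin_fun]
    at h3
  have h5 : LinearMap.range (Φ ∘ₗ Λ.subtype) =
      Submodule.span ℝ (Set.range ((fun i => Φ (q i)) ∘ a)) := by
    rw [hspan, LinearMap.range_comp, Submodule.range_subtype, Submodule.map_span, ← Set.range_comp]
    rfl
  rw [h5] at h2
  have h1' : Module.finrank ℝ (Submodule.span ℝ (Set.range ((fun i => Φ (q i)) ∘ a))) =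
    Fintype.card κ := h1
  omega

/-! ### Immersed pieces of the amoeba -/

theorem norm_character_eq_exp {n : ℕ} (m : Fin n → ℤ) (x : Torus n) :
    ‖((character m x : ℂˣ) : ℂ)‖ = Real.exp ((fun i => (m i : ℝ)) ⬝ᵥ Log x) := by
  rw [dotProduct, Real.exp_sum, character_apply, Units.coe_prod, norm_prod]
  refine Finset.prod_congr rfl fun i _ => ?_
  rw [Units.val_zpow_eq_zpow_val, norm_zpow, Log, mul_comm, Real.exp_mul, Real.exp_log
    (norm_pos_iff.2 (x i).ne_zero), Real.rpow_intCast]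

/-- A polynomial that vanishes at the exponentials of the points of an open set is zero. -/
theorem eq_zero_of_eval_exp {κ : Type} [Fintype κ] {p : MvPolynomial κ ℂ} {b : κ → ℝ}
    {O : Set (κ → ℝ)} (hO : O ∈ nhds b)
    (hp : ∀ y ∈ O, eval (fun k => ((Real.exp (y k) : ℝ) : ℂ) * (Real.exp (y k) : ℝ)) p = 0) :
    p = 0 := by
  obtain ⟨ε, hε, hball⟩ := Metric.mem_nhds_iff.1 hO
  let g : ℝ → ℂ := fun t => ((Real.exp t : ℝ) : ℂ) * (Real.exp t : ℝ)
  have hg : Function.Injective g := by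
    intro s t hst
    have h1 : Real.exp s * Real.exp s = Real.exp t * Real.exp t := by
      simp only [g] at hst
      exact_mod_cast hst
    rw [← Real.exp_add, ← Real.exp_add] at h1
    have := Real.exp_injective h1
    linarith
  -- A polynomial vanishing on a product of infinite sets is zero; the factors here are injective
  -- images of intervals.
  refine funext_set (fun k => g '' Metric.ball (b k) ε) (fun k => ?_) fun x hx => ?_
  · rw [Set.infinite_image_iff hg.injOn, Real.ball_eq_Ioo]
    exact Set.Ioo_infinite (by linarith)
  · choose y hy hyx using fun k => hx k (Set.mem_univ k)
    have : x = fun k => g (y k) := funext fun k => (hyx k).symm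
    rw [map_zero, this]
    refine hp y (hball ?_)
    rw [ball_pi _ hε]
    exact fun k _ => hy k

/-- The amoeba of `V` contains only pieces of dimension at most `dim T + 2 dim W`. -/
theorem natCast_le_of_immersion {n d : ℕ} (T : Subgroup (Torus n)) {V : Set (Torus n)}
    {U : Set (Fin d → ℝ)} {φ : (Fin d → ℝ) → (Fin n → ℝ)} (hU : IsOpen U) (hne : U.Nonempty)
    (hφ : AnalyticOnNhd ℝ φ U) (hinj : ∀ u ∈ U, Function.Injective (fderiv ℝ φ u))
    (hsub : φ '' U ⊆ amoeba V) :
    (d : WithBot ℕ∞) ≤ cdim (T : Set (Torus n)) + 2 * quotientDim T (quotientImage T V) := by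
  obtain ⟨u₀, hu₀⟩ := hne
  obtain ⟨r, hr, hrT⟩ := exists_le_cdim T
  obtain ⟨κ, _, a, hcard, hsurj⟩ := exists_surjective_functionals
    (fderiv ℝ φ u₀ : (Fin d → ℝ) →ₗ[ℝ] Fin n → ℝ) (hinj u₀ hu₀)
    (fun (m : annihilator T) (i : Fin n) => (m.1 i : ℝ))
  change _ + Module.finrank ℝ (annihilatorSpan T) ≤ _ at hcard
  rw [Module.finrank_fin_fun] at hcard
  have hdr : d ≤ r + Fintype.card κ := by omega
  let P : (Fin n → ℝ) →L[ℝ] κ → ℝ := LinearMap.toContinuousLinearMap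
    (LinearMap.pi fun k => dotProductEquiv ℝ (Fin n) fun i => ((a k).1 i : ℝ))
  have hder : HasStrictFDerivAt (fun u => P (φ u)) (P.comp (fderiv ℝ φ u₀)) u₀ :=
    P.hasStrictFDerivAt.comp u₀ (hφ u₀ hu₀).hasStrictFDerivAt
  -- A map with surjective strict derivative is open at the point, so the chosen values `log |χ|`
  -- fill a neighbourhood.
  have hmap := hder.map_nhds_eq_of_surj (LinearMap.range_eq_top.2 hsurj)
  have hO : (fun u => P (φ u)) '' U ∈ nhds (P (φ u₀)) := by
    rw [← hmap]
    exact Filter.image_mem_map (hU.mem_nhds hu₀)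
  have hWne : Nonempty ↥(quotientImage T V) := by
    obtain ⟨x, hx, -⟩ := hsub ⟨u₀, hu₀, rfl⟩
    exact ⟨⟨_, 1 * x, Set.mul_mem_mul T.one_mem hx, rfl⟩⟩
  have hκ : (Fintype.card κ : WithBot ℕ∞) ≤ 2 * quotientDim T (quotientImage T V) := by
    refine card_le_two_mul_ringKrullDim ((fg_quotientRegularFunctions T).map _)
      (fun k => ⟨_, quotientCharacter_mem T (a k), rfl⟩) ?_
    rw [AlgebraicIndependent, injective_iff_map_eq_zero]
    intro p hp
    refine eq_zero_of_eval_exp hO ?_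
    rintro _ ⟨u, hu, rfl⟩
    obtain ⟨x, hx, hxu⟩ := hsub ⟨u, hu, rfl⟩
    -- The relation on `W` is evaluated at the class of a point `x` of `V` over `φ u`, where `|χ|²`
    -- depends only on `Log x`.
    have h := congrFun hp ⟨QuotientGroup.mk x, x, ⟨1, T.one_mem, x, hx, one_mul x⟩, rfl⟩
    rw [aeval_def, eval₂_eq'] at h
    rw [eval_eq']
    simp only [Finset.sum_apply, Pi.mul_apply, Finset.prod_apply, Pi.pow_apply] at h
    refine Eq.trans (Finset.sum_congr rfl fun s _ => ?_) h
    congr 1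
    refine Finset.prod_congr rfl fun k _ => ?_
    congr 1
    have hn := norm_character_eq_exp (a k).1 x
    rw [hxu] at hn
    change _ = ((character (a k).1 x : ℂˣ) : ℂ) * (starRingEnd ℂ) ((character (a k).1 x : ℂˣ) : ℂ)
    rw [Complex.mul_conj, Complex.normSq_eq_norm_sq, hn]
    push_cast
    rw [sq]
    rfl
  calc (d : WithBot ℕ∞) ≤ (r : WithBot ℕ∞) + Fintype.card κ := by exact_mod_cast hdr
    _ ≤ _ := add_le_add hrT hκ

end TorusAmoeba

theorem mainTheorem5 (n : ℕ) (V : Set (TorusAmoeba.Torus n))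
    (hV : TorusAmoeba.IsIrreducibleSubvariety V)
    (hT : ∃ T : Subgroup (TorusAmoeba.Torus n), TorusAmoeba.IsSubtorus T ∧ T ≠ ⊥ ∧ T ≠ ⊤ ∧
      TorusAmoeba.HasDiminishingAction T V) :
    TorusAmoeba.realDim (TorusAmoeba.amoeba V) <
      min (n : WithBot ℕ∞) (2 * TorusAmoeba.cdim V) := by
  obtain ⟨T, -, -, -, hV2, hn⟩ := hT
  rw [add_comm] at hn
  refine lt_of_le_of_lt (sSup_le ?_) (lt_min hn hV2)
  rintro _ ⟨d, rfl, U, φ, hU, hne, hφ, hinj, hsub⟩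
  exact TorusAmoeba.natCast_le_of_immersion T hU hne hφ hinj hsub
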